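/- For $s,q\in(0,1)$ let $$\mathcal E_0(s,q)=\frac{2-q}{qs}\left[1-\frac{\log(1-q(1-s))}{(1-s)\log(1-q)}\right],\qquad A_n(s)=\frac{1-(1-s)^{n-1}}{s}\quad(n\ge 2),$$ and put $$B_n(s,q)=A_n(s)\bigl(1+\mathcal E_0(1-s,q)\bigr)^2+A_n(1-s)\bigl(1+\mathcal E_0(s,q)\bigr)^2 .$$ For integers $p\ge 4$ let $$Q_0(p,s)=\sum_{\substack{n\ge 2,\ m\ge 1\\ n+m=p}}\frac1n\,\frac1m\,2(n-m-1)\,B_n(s,q)\;-\sum_{\substack{n\ge 2,\ m\ge 1\\ n+m=p-1}}\frac1n\,\frac1m\,(n-m)\,B_n(s,q)$$ (a quantity that depends on $q$ as well, through $\mathcal E_0$), and let $$\mathcal I_0^{f}(s,q)=\sum_{p=4}^{10}Q_0(p,s)\,q^{p-4}.$$ **Theorem.** For every $s\in(0,1/2)$ and every $q\in(0,0.9]$ one has $\mathcal I_0^{f}(s,q)>0$. -/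

import Mathlib

namespace LogApsidal

noncomputable section

/-- The function `𝓔₀(s, q)` of the logarithmic potential (`α = 0`), for `s, q ∈ (0, 1)`. -/
def E0 (s q : ℝ) : ℝ :=
  (2 - q) / (q * s) * (1 - Real.log (1 - q * (1 - s)) / ((1 - s) * Real.log (1 - q)))

/-- The function `A_n(s)`, for `n ≥ 2` and `s ∈ (0, 1)`. -/
def A (n : ℕ) (s : ℝ) : ℝ :=
  (1 - (1 - s) ^ (n - 1)) / s

/-- The pairs `(n, m)` with `n ≥ 2`, `m ≥ 1` and `n + m = p`. -/
def pairs (p : ℕ) : Finset (ℕ × ℕ) :=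
  (Finset.HasAntidiagonal.antidiagonal p).filter fun x => 2 ≤ x.1 ∧ 1 ≤ x.2

/-- The bracket `A_n(s) (1 + 𝓔₀(1 - s, q))² + A_n(1 - s) (1 + 𝓔₀(s, q))²`. -/
def bracket (n : ℕ) (s q : ℝ) : ℝ :=
  A n s * (1 + E0 (1 - s) q) ^ 2 + A n (1 - s) * (1 + E0 s q) ^ 2

/-- The coefficient `Q₀(p, s)`, which depends on `q` as well, through `𝓔₀`. -/
def Q0 (p : ℕ) (s q : ℝ) : ℝ :=
  (∑ x ∈ pairs p,
      1 / (x.1 : ℝ) * (1 / (x.2 : ℝ)) * (2 * ((x.1 : ℝ) - (x.2 : ℝ) - 1)) * bracket x.1 s q) -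
    ∑ x ∈ pairs (p - 1),
      1 / (x.1 : ℝ) * (1 / (x.2 : ℝ)) * ((x.1 : ℝ) - (x.2 : ℝ)) * bracket x.1 s q

/-- The finite part `𝓘₀^f(s, q) = ∑_{p=4}^{10} Q₀(p, s) q^{p-4}`. -/
def finitePart (s q : ℝ) : ℝ :=
  ∑ p ∈ Finset.Icc 4 10, Q0 p s q * q ^ (p - 4)

end

end LogApsidal

namespace LogApsidal

open Finset

/-! With u = 1 - 2s, the sum is W(u) X² + W(-u) Y², where X = 1 + 𝓔₀(1-s,q), Y = 1 + 𝓔₀(s,q) and W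
is an explicit polynomial (`weight`). W(u) > 0 since its coefficients are positive, but W(-u) may be
negative. Bounds on 𝓔₀ uniform in its first argument give (1-q) Y² ≤ X² (`E0_ratio_bound`), so it
suffices that (1-q) W(u) + W(-u) > 0 (`weight_combination_pos`), a purely polynomial inequality. -/

/-- The coefficient of `(1 + E0 (1 - s) q) ^ 2` in `finitePart s q`, as a function of
`u = 1 - 2 * s`. -/
noncomputable def weight (u q : ℝ) : ℝ :=
    (1/3 * u) +
    (1/12 + 2/3 * u + 1/4 * u ^ 2) * q +
    (5/24 + 43/45 * u + 5/8 * u ^ 2 + 3/20 * u ^ 3) * q ^ 2 +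
    (83/240 + 6/5 * u + 49/48 * u ^ 2 + 9/20 * u ^ 3 + 1/12 * u ^ 4) * q ^ 3 +
    (77/160 + 197/140 * u + 133/96 * u ^ 2 + 281/336 * u ^ 3 + 7/24 * u ^ 4 +
      5/112 * u ^ 5) * q ^ 4 +
    (24527/40320 + 499/315 * u + 9797/5760 * u ^ 2 + 523/420 * u ^ 3 + 703/1152 * u ^ 4 +
      5/28 * u ^ 5 + 3/128 * u ^ 6) * q ^ 5 +
    (1299/1792 + 5471/3150 * u + 2517/1280 * u ^ 2 + 164737/100800 * u ^ 3 +
      255/256 * u ^ 4 + 839/2016 * u ^ 5 + 27/256 * u ^ 6 + 7/576 * u ^ 7) * q ^ 6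

theorem A_eq_geom_sum (n : ℕ) {s : ℝ} (hs : s ≠ 0) :
    A n s = ∑ i ∈ range (n - 1), (1 - s) ^ i := by
  have h := mul_neg_geom_sum (1 - s) (n - 1)
  rw [A, div_eq_iff hs, ← h]
  ring

theorem sum_pairs (p : ℕ) (f : ℕ × ℕ → ℝ) :
    ∑ x ∈ pairs p, f x = ∑ n ∈ Ico 2 p, f (n, p - n) := by
  symm
  refine sum_bij (fun n _ => (n, p - n)) ?_ ?_ ?_ ?_
  · intro n hn
    simp only [mem_Ico] at hn
    simp only [pairs, mem_filter, HasAntidiagonal.mem_antidiagonal]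
    omega
  · intro a _ b _ h
    exact congrArg Prod.fst h
  · rintro ⟨a, b⟩ h
    simp only [pairs, mem_filter, HasAntidiagonal.mem_antidiagonal] at h
    refine ⟨a, by simp only [mem_Ico]; omega, ?_⟩
    simp only [Prod.mk.injEq, true_and]
    omega
  · intro _ _
    rfl

theorem finitePart_eq {s q : ℝ} (hs : 0 < s) (hs' : s < 1) :
    finitePart s q = weight (1 - 2 * s) q * (1 + E0 (1 - s) q) ^ 2 +
      weight (2 * s - 1) q * (1 + E0 s q) ^ 2 := by
  have h1 : s ≠ 0 := hs.ne'
  have h2 : 1 - s ≠ 0 := by linarith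
  generalize hX : E0 (1 - s) q = X
  generalize hY : E0 s q = Y
  simp only [finitePart, Q0, sum_pairs, bracket, hX, hY, A_eq_geom_sum _ h1, A_eq_geom_sum _ h2]
  simp [sum_Ico_succ_top, sum_range_succ, ← Ico_succ_right_eq_Icc, weight]
  ring

theorem weight_pos {u q : ℝ} (hu : 0 < u) (hq : 0 < q) : 0 < weight u q := by
  unfold weight
  positivity

/-- The q-free terms of W(u) and W(-u) cancel, so a factor q splits off. In the quotient only the
q^6 coefficient is negative; as q ≤ 9/10, each lower power dominates a multiple of q^6, which
reduces everything to q = 9/10. -/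
theorem weight_combination_pos {u q : ℝ} (hu : 0 < u) (hu' : u < 1) (hq : 0 < q)
    (hq' : q ≤ 9 / 10) : 0 < (1 - q) * weight u q + weight (-u) q := by
  have h0 : 0 ≤ 1/6 - 1/3 * u + 1/2 * u ^ 2 := by
    nlinarith [sq_nonneg (u - 1 / 3)]
  have h1 : 0 ≤ 1/3 - 2/3 * u + 1 * u ^ 2 := by
    nlinarith [sq_nonneg (u - 1 / 3)]
  have h2 : 0 ≤ 29/60 - 43/45 * u + 17/12 * u ^ 2 - 3/20 * u ^ 3 + 1/6 * u ^ 4 := by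
    nlinarith [sq_nonneg (u - 1 / 3), sq_nonneg (u * (u - 1 / 3)), pow_pos hu 3,
      pow_pos hu 4, pow_pos hu 5, mul_nonneg hu.le (sub_nonneg.2 hu'.le),
      mul_nonneg (pow_pos hu 2).le (sub_nonneg.2 hu'.le),
      mul_nonneg (pow_pos hu 4).le (sub_nonneg.2 hu'.le)]
  have h3 : 0 ≤ 37/60 - 6/5 * u + 7/4 * u ^ 2 - 9/20 * u ^ 3 + 1/2 * u ^ 4 := by
    nlinarith [sq_nonneg (u - 1 / 3), sq_nonneg (u * (u - 1 / 3)), pow_pos hu 3,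
      pow_pos hu 4, pow_pos hu 5, mul_nonneg hu.le (sub_nonneg.2 hu'.le),
      mul_nonneg (pow_pos hu 2).le (sub_nonneg.2 hu'.le),
      mul_nonneg (pow_pos hu 4).le (sub_nonneg.2 hu'.le)]
  have h4 : 0 ≤ 2965/4032 - 197/140 * u + 5807/2880 * u ^ 2 - 281/336 * u ^ 3 +
      535/576 * u ^ 4 - 5/112 * u ^ 5 + 3/64 * u ^ 6 := by
    nlinarith [sq_nonneg (u - 1 / 3), sq_nonneg (u * (u - 1 / 3)), pow_pos hu 3,
      pow_pos hu 4, pow_pos hu 5, mul_nonneg hu.le (sub_nonneg.2 hu'.le),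
      mul_nonneg (pow_pos hu 2).le (sub_nonneg.2 hu'.le),
      mul_nonneg (pow_pos hu 4).le (sub_nonneg.2 hu'.le)]
  have h5 : 0 ≤ 4241/5040 - 499/315 * u + 1607/720 * u ^ 2 - 523/420 * u ^ 3 +
      199/144 * u ^ 4 - 5/28 * u ^ 5 + 3/16 * u ^ 6 := by
    nlinarith [sq_nonneg (u - 1 / 3), sq_nonneg (u * (u - 1 / 3)), pow_pos hu 3,
      pow_pos hu 4, pow_pos hu 5, mul_nonneg hu.le (sub_nonneg.2 hu'.le),
      mul_nonneg (pow_pos hu 2).le (sub_nonneg.2 hu'.le),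
      mul_nonneg (pow_pos hu 4).le (sub_nonneg.2 hu'.le)]
  -- The quotient at q = 9/10, divided by (9/10)^6.
  have hG : 0 < (1/6 - 1/3 * u + 1/2 * u ^ 2) * (10 / 9) ^ 6 +
        (1/3 - 2/3 * u + 1 * u ^ 2) * (10 / 9) ^ 5 +
        (29/60 - 43/45 * u + 17/12 * u ^ 2 - 3/20 * u ^ 3 + 1/6 * u ^ 4) * (10 / 9) ^ 4 +
        (37/60 - 6/5 * u + 7/4 * u ^ 2 - 9/20 * u ^ 3 + 1/2 * u ^ 4) * (10 / 9) ^ 3 +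
        (2965/4032 - 197/140 * u + 5807/2880 * u ^ 2 - 281/336 * u ^ 3 + 535/576 * u ^ 4 -
          5/112 * u ^ 5 + 3/64 * u ^ 6) * (10 / 9) ^ 2 +
        (4241/5040 - 499/315 * u + 1607/720 * u ^ 2 - 523/420 * u ^ 3 + 199/144 * u ^ 4 -
          5/28 * u ^ 5 + 3/16 * u ^ 6) * (10 / 9) ^ 1 +
        (- 1299/1792 - 5471/3150 * u - 2517/1280 * u ^ 2 - 164737/100800 * u ^ 3 -
          255/256 * u ^ 4 - 839/2016 * u ^ 5 - 27/256 * u ^ 6 - 7/576 * u ^ 7) := by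
    nlinarith [sq_nonneg (u - 3 / 5), sq_nonneg (u * (u - 3 / 5)),
      sq_nonneg (u ^ 2 * (u - 3 / 5)),
      pow_pos hu 3, pow_pos hu 5, mul_nonneg (pow_pos hu 6).le (sub_nonneg.2 hu'.le)]
  have hpow : ∀ k : ℕ, k ≤ 6 → (10 / 9) ^ (6 - k) * q ^ 6 ≤ q ^ k := by
    intro k hk
    have h : (10 / 9 * q) ^ (6 - k) ≤ 1 := pow_le_one₀ (by positivity) (by linarith)
    calc (10 / 9) ^ (6 - k) * q ^ 6 = (10 / 9 * q) ^ (6 - k) * q ^ k := by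
          rw [mul_pow, mul_assoc, ← pow_add, Nat.sub_add_cancel hk]
      _ ≤ q ^ k := mul_le_of_le_one_left (by positivity) h
  have e0 := mul_le_mul_of_nonneg_left (hpow 0 (by norm_num)) h0
  have e1 := mul_le_mul_of_nonneg_left (hpow 1 (by norm_num)) h1
  have e2 := mul_le_mul_of_nonneg_left (hpow 2 (by norm_num)) h2
  have e3 := mul_le_mul_of_nonneg_left (hpow 3 (by norm_num)) h3
  have e4 := mul_le_mul_of_nonneg_left (hpow 4 (by norm_num)) h4
  have e5 := mul_le_mul_of_nonneg_left (hpow 5 (by norm_num)) h5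
  have hsum : 0 < (1/6 - 1/3 * u + 1/2 * u ^ 2) +
        (1/3 - 2/3 * u + 1 * u ^ 2) * q +
        (29/60 - 43/45 * u + 17/12 * u ^ 2 - 3/20 * u ^ 3 + 1/6 * u ^ 4) * q ^ 2 +
        (37/60 - 6/5 * u + 7/4 * u ^ 2 - 9/20 * u ^ 3 + 1/2 * u ^ 4) * q ^ 3 +
        (2965/4032 - 197/140 * u + 5807/2880 * u ^ 2 - 281/336 * u ^ 3 + 535/576 * u ^ 4 -
          5/112 * u ^ 5 + 3/64 * u ^ 6) * q ^ 4 +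
        (4241/5040 - 499/315 * u + 1607/720 * u ^ 2 - 523/420 * u ^ 3 + 199/144 * u ^ 4 -
          5/28 * u ^ 5 + 3/16 * u ^ 6) * q ^ 5 +
        (- 1299/1792 - 5471/3150 * u - 2517/1280 * u ^ 2 - 164737/100800 * u ^ 3 -
          255/256 * u ^ 4 - 839/2016 * u ^ 5 - 27/256 * u ^ 6 - 7/576 * u ^ 7) * q ^ 6 := by
    refine lt_of_lt_of_le (mul_pos hG (pow_pos hq 6)) ?_
    norm_num only [pow_zero, pow_one, mul_one] at e0 e1 e2 e3 e4 e5 ⊢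
    linarith
  refine (mul_pos hq hsum).trans_eq ?_
  unfold weight
  ring

theorem hasSum_neg_log_one_sub {x : ℝ} (h0 : 0 ≤ x) (h1 : x < 1) :
    HasSum (fun n : ℕ => x ^ (n + 1) / (n + 1)) (-Real.log (1 - x)) :=
  Real.hasSum_pow_div_log_of_abs_lt_one (by rwa [abs_of_nonneg h0])

theorem E0_eq {s q : ℝ} (hs : 0 < s) (hs' : s < 1) (hq : 0 < q) (hq' : q < 1) :
    E0 s q = (2 - q) / (q * -Real.log (1 - q)) *
      (((1 - s) * -Real.log (1 - q) - -Real.log (1 - q * (1 - s))) / (s * (1 - s))) := by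
  have hL : Real.log (1 - q) < 0 := Real.log_neg (by linarith) (by linarith)
  have h1 : 1 - s ≠ 0 := by linarith
  unfold E0
  field_simp [hL.ne]
  ring

/-- Termwise in the log series: (1-s) - (1-s)^k ≥ s(1-s) for k ≥ 2, while the k = 1 term vanishes,
whence the subtracted q. -/
theorem log_gap_lower {s q : ℝ} (hs : 0 < s) (hs' : s < 1) (hq : 0 < q) (hq' : q < 1) :
    s * (1 - s) * (-Real.log (1 - q) - q) ≤
      (1 - s) * -Real.log (1 - q) - -Real.log (1 - q * (1 - s)) := by
  have hL := hasSum_neg_log_one_sub hq.le hq'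
  have hM := hasSum_neg_log_one_sub (x := q * (1 - s)) (by nlinarith) (by nlinarith)
  have hq1 : HasSum (fun n : ℕ => if n = 0 then q else 0) q := hasSum_ite_eq 0 q
  refine hasSum_le ?_ ((hL.sub hq1).mul_left (s * (1 - s))) ((hL.mul_left (1 - s)).sub hM)
  rintro (_ | n)
  · simp
    linarith
  · have ht : (1 - s) ^ n ≤ 1 := pow_le_one₀ (by linarith) (by linarith)
    have hc : 0 ≤ q ^ (n + 1 + 1) / ((n + 1 : ℕ) + 1 : ℝ) := by positivity
    have key : 0 ≤ (1 - s) - (1 - s) ^ (n + 1 + 1) - s * (1 - s) := by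
      have := mul_nonneg (sq_nonneg (1 - s)) (sub_nonneg.2 ht)
      rw [pow_succ, pow_succ]
      nlinarith
    have := mul_nonneg hc key
    simp only [Nat.add_eq_zero_iff, one_ne_zero, and_false, if_false, mul_pow]
    ring_nf at this ⊢
    linarith

theorem log_gap_upper {s q : ℝ} (hs : 0 < s) (hs' : s < 1) (hq : 0 < q) (hq' : q < 1) :
    (1 - s) * -Real.log (1 - q) - -Real.log (1 - q * (1 - s)) ≤
      s * (1 - s) * (q / (1 - q) - -Real.log (1 - q)) := by
  have hL := hasSum_neg_log_one_sub hq.le hq'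
  have hM := hasSum_neg_log_one_sub (x := q * (1 - s)) (by nlinarith) (by nlinarith)
  have hg : HasSum (fun n : ℕ => q * q ^ n) (q / (1 - q)) :=
    (hasSum_geometric_of_lt_one hq.le hq').mul_left q
  refine hasSum_le (fun n => ?_) ((hL.mul_left (1 -
      s)).sub hM) ((hg.sub hL).mul_left (s * (1 - s)))
  -- Bernoulli: 1 - (1-s)^n ≤ ns.
  have hb := one_add_mul_le_pow (a := -s) (by linarith) n
  have hc : 0 ≤ q ^ (n + 1) / (n + 1 : ℝ) * (1 - s) := by
    have : 0 ≤ 1 - s := by linarith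
    positivity
  have h := mul_le_mul_of_nonneg_left hb hc
  have e : q * q ^ n = q ^ (n + 1) / (n + 1 : ℝ) * (n + 1) := by
    field_simp
    ring
  rw [e, mul_pow, pow_succ (1 - s)]
  ring_nf at h ⊢
  linarith

theorem E0_lower {s q : ℝ} (hs : 0 < s) (hs' : s < 1) (hq : 0 < q) (hq' : q < 1) :
    (2 - q) * (1 / q - 1 / -Real.log (1 - q)) ≤ E0 s q := by
  have hL : 0 < -Real.log (1 - q) := neg_pos.2 (Real.log_neg (by linarith) (by linarith))
  have hst : 0 < s * (1 - s) := mul_pos hs (by linarith)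
  have h := (le_div_iff₀' hst).2 (log_gap_lower hs hs' hq hq')
  rw [E0_eq hs hs' hq hq']
  refine le_trans (le_of_eq ?_)
    (mul_le_mul_of_nonneg_left h (div_nonneg (by linarith) (mul_pos hq hL).le))
  generalize -Real.log (1 - q) = L at hL
  field_simp

theorem E0_pos {s q : ℝ} (hs : 0 < s) (hs' : s < 1) (hq : 0 < q) (hq' : q < 1) :
    0 < E0 s q := by
  have hL : q < -Real.log (1 - q) := by
    linarith [Real.log_lt_sub_one_of_pos (x := 1 - q) (by linarith) (by linarith)]
  have h := one_div_lt_one_div_of_lt hq hL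
  exact (mul_pos (by linarith) (sub_pos.2 h)).trans_le (E0_lower hs hs' hq hq')

theorem E0_upper {s q : ℝ} (hs : 0 < s) (hs' : s < 1) (hq : 0 < q) (hq' : q < 1) :
    E0 s q ≤ (2 - q) * (1 / ((1 - q) * -Real.log (1 - q)) - 1 / q) := by
  have hL : 0 < -Real.log (1 - q) := neg_pos.2 (Real.log_neg (by linarith) (by linarith))
  have hst : 0 < s * (1 - s) := mul_pos hs (by linarith)
  have h := (div_le_iff₀' hst).2 (log_gap_upper hs hs' hq hq')
  rw [E0_eq hs hs' hq hq']
  refine (mul_le_mul_of_nonneg_left h (div_nonneg (by linarith) (mul_pos hq hL).le)).trans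
    (le_of_eq ?_)
  generalize -Real.log (1 - q) = L at hL
  have : 1 - q ≠ 0 := by linarith
  field_simp

theorem artanh_bound_le_neg_log {x : ℝ} (hx : 0 ≤ x) (hx' : x < 1) :
    2 * x * (1 + x ^ 2 / 3) ≤ -Real.log (1 - 2 * x / (1 + x)) := by
  have h := Real.sum_range_le_log_div hx hx' 2
  have e : 1 - 2 * x / (1 + x) = ((1 + x) / (1 - x))⁻¹ := by
    have : 1 - x ≠ 0 := by linarith
    field_simp
    ring
  rw [e, Real.log_inv, neg_neg]
  simp [sum_range_succ] at h
  linarith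

/-- The difference of the sides is odd in x: it is 2x times a cubic in x², decreasing for x² ≥ 0 and
still positive at x = 9/11. -/
theorem pade_ratio_bound {x : ℝ} (hx : 0 < x) (hx' : x ≤ 9 / 11) :
    (1 + x) * (2 - 4 * x / 3 + 2 * x ^ 2 / 3 - x ^ 3 / 3) ^ 2 ≤
      (1 - x) * (2 + 4 * x / 3 + 2 * x ^ 2 / 3 + x ^ 3 / 3) ^ 2 := by
  have hy : x ^ 2 ≤ 81 / 121 := by nlinarith
  have hy0 : 0 ≤ x ^ 2 := sq_nonneg x
  have h : 0 ≤ 4 / 3 - 4 * x ^ 2 / 3 - 8 * (x ^ 2) ^ 2 / 9 - (x ^ 2) ^ 3 / 9 := by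
    generalize x ^ 2 = y at hy hy0
    have h2 : y ^ 2 ≤ (81 / 121) ^ 2 := pow_le_pow_left₀ hy0 hy 2
    have h3 : y ^ 3 ≤ (81 / 121) ^ 3 := pow_le_pow_left₀ hy0 hy 3
    norm_num at h2 h3
    linarith
  have := mul_nonneg hx.le h
  nlinarith

theorem E0_ratio_bound {s t q : ℝ} (hs : 0 < s) (hs' : s < 1) (ht : 0 < t) (ht' : t < 1)
    (hq : 0 < q) (hq' : q ≤ 9 / 10) :
    (1 - q) * (1 + E0 s q) ^ 2 ≤ (1 + E0 t q) ^ 2 := by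
  -- Now -log(1-q) = log((1+x)/(1-x)), and q = 9/10 corresponds to x = 9/11.
  obtain ⟨x, hx, hx', rfl⟩ : ∃ x : ℝ, 0 < x ∧ x ≤ 9 / 11 ∧ q = 2 * x / (1 + x) := by
    have h2 : 0 < 2 - q := by linarith
    refine ⟨q / (2 - q), div_pos hq h2, ?_, ?_⟩
    · rw [div_le_iff₀ h2]
      linarith
    · field_simp
      ring
  have hl := artanh_bound_le_neg_log hx.le (by linarith : x < 1)
  have hlo := E0_lower ht ht' hq (by linarith)
  have hb0 : 0 ≤ 1 + E0 s (2 * x / (1 + x)) := by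
    linarith [E0_pos hs hs' hq (by linarith)]
  have hup := E0_upper hs hs' hq (by linarith)
  set q := 2 * x / (1 + x) with hqx
  set L := -Real.log (1 - q)
  set l := 2 * x * (1 + x ^ 2 / 3) with hlx
  have hl1 : 0 < l := by positivity
  have hxx : 0 < 1 - x := by linarith
  have hq1 : 1 - q = (1 - x) / (1 + x) := by
    rw [hqx]; field_simp; ring
  have hq2 : 2 - q = 2 / (1 + x) := by
    rw [hqx]; field_simp; ring
  have hqp : 0 < 1 - q := by rw [hq1]; positivity
  have hqp2 : 0 < 2 - q := by rw [hq2]; positivity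
  -- Replacing L by the smaller l weakens both the lower and the upper bound on 𝓔₀, so one estimate
  -- of the logarithm serves both.
  have hinv : 1 / L ≤ 1 / l := one_div_le_one_div_of_le hl1 hl
  have ha : (2 + 4 * x / 3 + 2 * x ^ 2 / 3 + x ^ 3 / 3) / ((1 + x) * (1 + x ^ 2 / 3)) ≤
      1 + E0 t q := by
    have h := mul_le_mul_of_nonneg_left (sub_le_sub_left hinv (1 / q)) hqp2.le
    have e : 1 + (2 - q) * (1 / q - 1 / l) =
        (2 + 4 * x / 3 + 2 * x ^ 2 / 3 + x ^ 3 / 3) / ((1 + x) * (1 + x ^ 2 / 3)) := by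
      rw [hq2, hqx, hlx]; field_simp; ring
    linarith
  have hb : 1 + E0 s q ≤
      (2 - 4 * x / 3 + 2 * x ^ 2 / 3 - x ^ 3 / 3) / ((1 - x) * (1 + x ^ 2 / 3)) := by
    have hinv' : 1 / ((1 - q) * L) ≤ 1 / ((1 - q) * l) :=
      one_div_le_one_div_of_le (mul_pos hqp hl1) (mul_le_mul_of_nonneg_left hl hqp.le)
    have h := mul_le_mul_of_nonneg_left (sub_le_sub_right hinv' (1 / q)) hqp2.le
    have e : 1 + (2 - q) * (1 / ((1 - q) * l) - 1 / q) =
        (2 - 4 * x / 3 + 2 * x ^ 2 / 3 - x ^ 3 / 3) / ((1 - x) * (1 + x ^ 2 / 3)) := by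
      rw [hq2, hq1, hqx, hlx]; field_simp; ring
    linarith
  refine (mul_le_mul_of_nonneg_left (pow_le_pow_left₀ hb0 hb 2) hqp.le).trans
    (le_trans ?_ (pow_le_pow_left₀ (by positivity) ha 2))
  have key := pade_ratio_bound hx hx'
  rw [hq1, div_pow, div_pow, div_mul_div_comm, div_le_div_iff₀ (by positivity) (by positivity)]
  have hm : 0 ≤ (1 - x) * (1 + x) * (1 + x ^ 2 / 3) ^ 2 := by positivity
  have := mul_le_mul_of_nonneg_left key hm
  linarith

theorem finitePart_pos {s q : ℝ} (hs0 : 0 < s) (hs1 : s < 1 / 2) (hq0 : 0 < q)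
    (hq1 : q ≤ 9 / 10) : 0 < finitePart s q := by
  have hu : 0 < 1 - 2 * s := by linarith
  have hE : 0 < E0 s q := E0_pos hs0 (by linarith) hq0 (by linarith)
  have hr : (1 - q) * (1 + E0 s q) ^ 2 ≤ (1 + E0 (1 - s) q) ^ 2 :=
    E0_ratio_bound hs0 (by linarith) (by linarith) (by linarith) hq0 hq1
  have hw := weight_combination_pos hu (by linarith) hq0 hq1
  rw [neg_sub] at hw
  calc 0 < ((1 - q) * weight (1 - 2 * s) q + weight (2 * s - 1) q) * (1 + E0 s q) ^ 2 :=
        mul_pos hw (by positivity)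
    _ = weight (1 - 2 * s) q * ((1 - q) * (1 + E0 s q) ^ 2) +
        weight (2 * s - 1) q * (1 + E0 s q) ^ 2 := by ring
    _ ≤ weight (1 - 2 * s) q * (1 + E0 (1 - s) q) ^ 2 +
        weight (2 * s - 1) q * (1 + E0 s q) ^ 2 := by
        have := mul_le_mul_of_nonneg_left hr (weight_pos hu hq0).le
        linarith
    _ = finitePart s q := (finitePart_eq hs0 (by linarith)).symm

end LogApsidal

theorem mainTheorem3 (s q : ℝ) (hs : s ∈ Set.Ioo (0 : ℝ) (1 / 2))
    (hq : q ∈ Set.Ioc (0 : ℝ) (9 / 10)) :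
    0 < LogApsidal.finitePart s q :=
  LogApsidal.finitePart_pos hs.1 hs.2 hq.1 hq.2
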